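/- Let $k$ be an algebraically closed field, let $n\ge 1$ be an integer not divisible by $\operatorname{char} k$ (no condition if $\operatorname{char} k=0$), let $a\ge 0$ be an integer coprime to $n$, and let $\xi\in k$ be a primitive $n$-th root of unity. Let $G=\frac1n(1,a)\subset \mathrm{GL}(2,k)$ be the cyclic group generated by $\begin{pmatrix}\xi&0\\0&\xi^a\end{pmatrix}$, acting on $S=k[[u,v]]$ by linear changes of variables, so that the generator sends $u\mapsto \xi u$ and $v\mapsto \xi^a v$. Let $R=S^G$ be the invariant ring, a Noetherian local ring with residue field $k$, and let $M=\mathrm{Syz}^2_R(k)$ be the second syzygy module of $k$, that is, $M=\ker(R^{\beta_1}\to R^{\beta_0})$ for a minimal free resolution $\cdots\to R^{\beta_1}\to R^{\beta_0}\to k\to 0$ of $k$ over $R$. Let $$V=\mathcal A'(M)=(S\otimes_R M)^{**}\otimes_S k,\qquad (-)^*=\mathrm{Hom}_S(-,S),$$ be the $k$-representation of $G$ that corresponds to $M$ under the Auslander correspondence; here $G$ acts on $S\otimes_R M$ through the first factor, on a dual by $g\cdot\varphi=g\circ\varphi\circ g^{-1}$, and on $V=(S\otimes_R M)^{**}/\mathfrak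 m_S(S\otimes_R M)^{**}$ by the induced action. Then $V$ is a faithful representation of $G$, i.e. the homomorphism $G\to \mathrm{GL}(V)$ is injective. -/

import Mathlib

open scoped TensorProduct

/-! ### Linear action of matrices on formal power series -/

namespace LinearAction

variable {k σ : Type*} [Field k] [Fintype σ]

/-- The linear form `g(x_j) = ∑ i, g_{ij} x_i`, the image of the variable `x_j` under the matrix `g`
acting on the space of linear forms with basis `(x_i)`. -/
noncomputable def form (g : Matrix σ σ k) (j : σ) : MvPowerSeries σ k :=
  ∑ i, g i j • MvPowerSeries.X i

theorem hasSubst_form (g : Matrix σ σ k) : MvPowerSeries.HasSubst (form g) :=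
  MvPowerSeries.hasSubst_of_constantCoeff_zero fun j => by
    simp [form, map_sum]

theorem subst_form (g h : Matrix σ σ k) (j : σ) :
    MvPowerSeries.subst (form g) (form h j) = form (g * h) j := by
  rw [← MvPowerSeries.coe_substAlgHom (hasSubst_form g)]
  simp only [form, map_sum, map_smul, MvPowerSeries.substAlgHom_X, Matrix.mul_apply,
    Finset.smul_sum, Finset.sum_smul, smul_smul]
  rw [Finset.sum_comm]
  simp only [mul_comm]

variable [DecidableEq σ]

/-- `GL(σ, k)` acts on `k[[x_i : i ∈ σ]]` by linear changes of variables. -/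
noncomputable instance : MulSemiringAction (GL σ k) (MvPowerSeries σ k) where
  smul g f := MvPowerSeries.subst (form g.1) f
  one_smul f := by
    change MvPowerSeries.subst (form (1 : Matrix σ σ k)) f = f
    have : form (1 : Matrix σ σ k) = MvPowerSeries.X := by
      funext j
      simp [form, Matrix.one_apply]
    rw [this, MvPowerSeries.subst_self, id]
  mul_smul g h f := by
    change MvPowerSeries.subst (form (g.1 * h.1)) f =
      MvPowerSeries.subst (form g.1) (MvPowerSeries.subst (form h.1) f)
    rw [MvPowerSeries.subst_comp_subst_apply (hasSubst_form _) (hasSubst_form _)]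
    congr 1
    funext j
    exact (subst_form _ _ _).symm
  smul_zero g := by
    change MvPowerSeries.subst (form g.1) _ = _
    rw [← MvPowerSeries.coe_substAlgHom (hasSubst_form _), map_zero]
  smul_add g := MvPowerSeries.subst_add (hasSubst_form _)
  smul_one g := by
    change MvPowerSeries.subst (form g.1) _ = _
    rw [← MvPowerSeries.coe_substAlgHom (hasSubst_form _), map_one]
  smul_mul g := MvPowerSeries.subst_mul (hasSubst_form _)

theorem smul_def (g : GL σ k) (f : MvPowerSeries σ k) :
    g • f = MvPowerSeries.subst (form g.1) f := rfl

instance : SMulCommClass (GL σ k) k (MvPowerSeries σ k) where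
  smul_comm g c f := MvPowerSeries.subst_smul (hasSubst_form g.1) c f

end LinearAction

/-- The cyclic group `1/n (1, a)` in `GL(2, k)`: the subgroup generated by the diagonal matrix with
entries `ξ, ξ ^ a` (to be used for `ξ` a primitive `n`-th root of unity). -/
noncomputable def cyclicGroup {k : Type*} [Field k] (ξ : kˣ) (a : ℕ) :
    Subgroup (GL (Fin 2) k) :=
  Subgroup.zpowers
    (Matrix.GeneralLinearGroup.mk' (Matrix.diagonal ![(ξ : k), (ξ : k) ^ a])
      (invertibleOfNonzero (by simp [Matrix.det_diagonal])))

/-! ### Invariant rings -/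

section Invariants

variable (k S G : Type*) [CommRing k] [CommRing S] [Algebra k S] [Group G]
  [MulSemiringAction G S] [SMulCommClass G k S]

/-- The invariant ring `S ^ G`, as a `k`-subalgebra of `S`. -/
abbrev InvariantRing : Subalgebra k S := FixedPoints.subalgebra k S G

instance InvariantRing.isLocalRing [IsLocalRing S] : IsLocalRing (InvariantRing k S G) := by
  have : IsLocalHom (InvariantRing k S G).val.toRingHom := by
    refine ⟨fun x hx => ?_⟩
    obtain ⟨u, hu⟩ := hx
    have hu' : (u : S) = (x : S) := hu
    have hinv : ∀ g : G, g • ((u⁻¹ : Sˣ) : S) = ((u⁻¹ : Sˣ) : S) := fun g => by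
      have h1 : g • (u : S) = u := by rw [hu']; exact x.2 g
      have h2 : (g • ((u⁻¹ : Sˣ) : S)) * (u : S) = 1 := by
        conv_lhs => rw [← h1]
        rw [← smul_mul', Units.inv_mul, smul_one]
      exact (Units.mul_eq_one_iff_eq_inv).1 h2
    refine IsUnit.of_mul_eq_one (⟨((u⁻¹ : Sˣ) : S), hinv⟩ : InvariantRing k S G) ?_
    apply Subtype.ext
    change (x : S) * ((u⁻¹ : Sˣ) : S) = 1
    rw [← hu', Units.mul_inv]
  exact RingHom.domain_isLocalRing (InvariantRing k S G).val.toRingHom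

end Invariants

/-- The invariant ring of a Noetherian ring under a finite group of invertible order is Noetherian
(so that minimal free resolutions over it exist). -/
theorem InvariantRing.isNoetherianRing (k S G : Type*) [Field k] [CommRing S] [Algebra k S]
    [Group G] [Fintype G] [MulSemiringAction G S] [SMulCommClass G k S] [IsNoetherianRing S]
    (h : (Fintype.card G : k) ≠ 0) : IsNoetherianRing (InvariantRing k S G) := by
  let R := InvariantRing k S G
  have key : ∀ I : Ideal R, (I.map (algebraMap R S)).comap (algebraMap R S) = I := by
    let c : k := (Fintype.card G : k)⁻¹
    let ρ : S →ₗ[R] R :=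
      { toFun := fun s => ⟨c • ∑ g : G, g • s, fun g => by
          rw [smul_comm, Finset.smul_sum]
          congr 1
          exact Fintype.sum_equiv (Equiv.mulLeft g) _ _ (fun h => by simp [mul_smul])⟩
        map_add' := fun x y => by ext; simp [Finset.sum_add_distrib]
        map_smul' := fun r x => by
          ext
          have : ∀ g : G, g • (r • x) = r • (g • x) := fun g => smul_comm g r x
          simp only [this, ← Finset.smul_sum, RingHom.id_apply]
          exact smul_comm c r _ }
    have hρ : ∀ r : R, ρ (algebraMap R S r) = r := fun r => by
      ext
      change c • ∑ g : G, g • (r : S) = r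
      have : ∀ g : G, g • (r : S) = r := fun g => r.2 g
      simp only [this, Finset.sum_const, Finset.card_univ]
      rw [← Nat.cast_smul_eq_nsmul k, smul_smul, inv_mul_cancel₀ h, one_smul]
    intro I
    refine le_antisymm ?_ Ideal.le_comap_map
    intro r hr
    rw [Ideal.mem_comap] at hr
    have : ∀ s ∈ I.map (algebraMap R S), ρ s ∈ I := by
      intro s hs
      refine Submodule.span_induction (p := fun s _ => ∀ t : S, ρ (t * s) ∈ I) ?_ ?_ ?_ ?_ hs 1 |>
        fun h => by simpa using h
      · rintro _ ⟨i, hi, rfl⟩ t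
        have : t * algebraMap R S i = i • t := by rw [Algebra.smul_def, mul_comm]
        rw [this, map_smul]
        exact I.mul_mem_right _ hi
      · simp
      · intro x y _ _ hx hy t
        rw [mul_add, map_add]; exact add_mem (hx t) (hy t)
      · intro a x _ hx t
        rw [smul_eq_mul, ← mul_assoc]; exact hx _
    rw [← hρ r]; exact this _ hr
  rw [isNoetherianRing_iff, isNoetherian_iff']
  have : WellFoundedGT (Ideal S) := inferInstance
  exact StrictMono.wellFoundedGT (f := fun I : Ideal R => I.map (algebraMap R S))
    (Monotone.strictMono_of_injective (fun _ _ h => Ideal.map_mono h)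
      (fun I J h => by rw [← key I, ← key J]; exact congrArg _ h))

/-! ### Minimal free resolutions -/

/-- A minimal free resolution `⋯ → R ^ (b 2) → R ^ (b 1) → R ^ (b 0) → M → 0` of the module `M` over
the local ring `R`. -/
structure MinimalFreeResolution (R M : Type*) [CommRing R] [IsLocalRing R] [AddCommGroup M]
    [Module R M] where
  /-- The Betti numbers. -/
  b : ℕ → ℕ
  /-- The augmentation. -/
  ε : (Fin (b 0) → R) →ₗ[R] M
  /-- The differentials. -/
  d : ∀ i, (Fin (b (i + 1)) → R) →ₗ[R] (Fin (b i) → R)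
  surjective : Function.Surjective ε
  exact_zero : LinearMap.range (d 0) = LinearMap.ker ε
  exact_succ : ∀ i, LinearMap.range (d (i + 1)) = LinearMap.ker (d i)
  minimal : ∀ i, LinearMap.range (d i) ≤
    IsLocalRing.maximalIdeal R • (⊤ : Submodule R (Fin (b i) → R))

namespace MinimalFreeResolution

variable {R M : Type*} [CommRing R] [IsLocalRing R] [AddCommGroup M] [Module R M]

/-- The second syzygy module: the kernel of `R ^ (b 1) → R ^ (b 0)`. -/
def secondSyzygy (F : MinimalFreeResolution R M) : Submodule R (Fin (F.b 1) → R) :=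
  LinearMap.ker (F.d 0)

theorem exists_cover (R M : Type*) [CommRing R] [IsLocalRing R] [AddCommGroup M] [Module R M]
    [Module.Finite R M] : ∃ (b : ℕ) (φ : (Fin b → R) →ₗ[R] M), Function.Surjective φ ∧
      LinearMap.ker φ ≤ IsLocalRing.maximalIdeal R • (⊤ : Submodule R (Fin b → R)) := by
  let κ := IsLocalRing.ResidueField R
  let B := Module.finBasis κ (κ ⊗[R] M)
  have hsurj : Function.Surjective (TensorProduct.mk R κ M 1) :=
    TensorProduct.mk_surjective R M κ IsLocalRing.residue_surjective
  choose f hf using fun i => hsurj (B i)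
  refine ⟨_, Fintype.linearCombination R f, ?_, ?_⟩
  · rw [← LinearMap.range_eq_top, Fintype.range_linearCombination]
    exact IsLocalRing.span_eq_top_of_tmul_eq_basis f B hf
  · intro x hx
    have h0 : ∑ i, IsLocalRing.residue R (x i) • B i = 0 := by
      rw [LinearMap.mem_ker, Fintype.linearCombination_apply] at hx
      have := congrArg (TensorProduct.mk R κ M 1) hx
      simpa [map_sum, hf, ← IsLocalRing.ResidueField.algebraMap_eq, algebraMap_smul] using this
    have hx' : ∀ i, x i ∈ IsLocalRing.maximalIdeal R := fun i =>
      (IsLocalRing.residue_eq_zero_iff _).1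
        ((Fintype.linearIndependent_iff.1 B.linearIndependent) _ h0 i)
    rw [pi_eq_sum_univ x]
    exact Submodule.sum_mem _ fun i _ => Submodule.smul_mem_smul (hx' i) Submodule.mem_top

/-- Finitely generated modules over Noetherian local rings have minimal free resolutions. -/
theorem nonempty (R M : Type*) [CommRing R] [IsLocalRing R] [IsNoetherianRing R] [AddCommGroup M]
    [Module R M] [Module.Finite R M] : Nonempty (MinimalFreeResolution R M) := by
  obtain ⟨b₀, ε, hε, hker⟩ := exists_cover R M
  have step : ∀ K : (Σ b : ℕ, Submodule R (Fin b → R)),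
      ∃ (b : ℕ) (f : (Fin b → R) →ₗ[R] (Fin K.1 → R)), LinearMap.range f = K.2 ∧
        LinearMap.ker f ≤ IsLocalRing.maximalIdeal R • (⊤ : Submodule R (Fin b → R)) := by
    intro K
    obtain ⟨b, φ, h1, h2⟩ := exists_cover R K.2
    refine ⟨b, K.2.subtype ∘ₗ φ, ?_, ?_⟩
    · rw [LinearMap.range_comp, LinearMap.range_eq_top.2 h1, Submodule.map_top,
        Submodule.range_subtype]
    · rwa [LinearMap.ker_comp_of_ker_eq_bot _ (Submodule.ker_subtype _)]
  choose nb nf h1 h2 using step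
  let K : ℕ → (Σ b : ℕ, Submodule R (Fin b → R)) := fun i =>
    Nat.rec ⟨b₀, LinearMap.ker ε⟩ (fun _ K => ⟨nb K, LinearMap.ker (nf K)⟩) i
  refine ⟨⟨fun i => (K i).1, ε, fun i => nf (K i), hε, h1 (K 0), fun i => h1 (K (i + 1)), ?_⟩⟩
  intro i
  rw [h1]
  cases i with
  | zero => exact hker
  | succ i => exact h2 (K i)

end MinimalFreeResolution

/-! ### Modules over the skew group ring -/

/-- A structure of module over the skew group ring `S * G` on the `S`-module `X`: an additive action
of `G` on `X` with `g (s x) = g(s) g(x)`. -/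
structure SkewAction (G S X : Type*) [Group G] [CommRing S] [MulSemiringAction G S]
    [AddCommGroup X] [Module S X] where
  /-- The action of an element of the group. -/
  act : G → X →+ X
  act_one : ∀ x, act 1 x = x
  act_mul : ∀ g h x, act (g * h) x = act g (act h x)
  act_smul : ∀ (g : G) (s : S) (x : X), act g (s • x) = (g • s) • act g x

namespace SkewAction

variable {G S X : Type*} [Group G] [CommRing S] [MulSemiringAction G S]
  [AddCommGroup X] [Module S X]

/-- The action of `S * G` on `Hom_S(X, S)`: `g` sends `φ` to `g ∘ φ ∘ g⁻¹`. -/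
def dual (τ : SkewAction G S X) : SkewAction G S (Module.Dual S X) where
  act g :=
    { toFun φ :=
        { toFun x := g • φ (τ.act g⁻¹ x)
          map_add' x y := by simp
          map_smul' s x := by simp [τ.act_smul, smul_mul'] }
      map_zero' := by ext; simp
      map_add' φ ψ := by ext; simp }
  act_one φ := by ext; simp [τ.act_one]
  act_mul g h φ := by ext; simp [mul_smul, τ.act_mul]
  act_smul g s φ := by ext; simp [smul_mul']

theorem act_mem (τ : SkewAction G S X) [IsLocalRing S] (g : G) {x : X}
    (hx : x ∈ IsLocalRing.maximalIdeal S • (⊤ : Submodule S X)) :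
    τ.act g x ∈ IsLocalRing.maximalIdeal S • (⊤ : Submodule S X) := by
  induction hx using Submodule.smul_induction_on' with
  | smul s hs x _ =>
    rw [τ.act_smul]
    refine Submodule.smul_mem_smul ?_ Submodule.mem_top
    rw [IsLocalRing.mem_maximalIdeal, mem_nonunits_iff] at hs ⊢
    intro h
    apply hs
    have := h.map (MulSemiringAction.toRingHom G S g⁻¹)
    simpa using this
  | add x _ y _ hx hy => rw [map_add]; exact add_mem hx hy

section

variable (k : Type*) [Field k] [Algebra k S] [SMulCommClass G k S] [Module k X]
  [IsScalarTower k S X]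

/-- The action of a group element on `X`, which is linear over the invariant field `k`. -/
def actLin (τ : SkewAction G S X) (g : G) : X →ₗ[k] X where
  toFun := τ.act g
  map_add' := map_add _
  map_smul' c x := by
    rw [← algebraMap_smul S c x, τ.act_smul, smul_algebraMap, algebraMap_smul, RingHom.id_apply]

/-- The representation of `G` on `X ⊗_S S/𝔪 = X/𝔪X`, for a local ring `S` with maximal ideal `𝔪`,
induced by an action of `S * G` on `X`: it sends the class of `x` to the class of `g x`. -/
def residueRep [IsLocalRing S] (τ : SkewAction G S X) :
    Representation k G (X ⧸ (IsLocalRing.maximalIdeal S • (⊤ : Submodule S X))) where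
  toFun g :=
    { toFun := Quotient.map' (τ.act g) fun x y hxy => by
        rw [Submodule.quotientRel_def] at hxy ⊢
        rw [← map_sub]
        exact τ.act_mem g hxy
      map_add' := by
        rintro ⟨x⟩ ⟨y⟩
        exact congrArg Submodule.Quotient.mk (map_add (τ.act g) x y)
      map_smul' := by
        rintro c ⟨x⟩
        exact congrArg Submodule.Quotient.mk (map_smul (τ.actLin k g) c x) }
  map_one' := by
    apply LinearMap.ext
    rintro ⟨x⟩
    exact congrArg Submodule.Quotient.mk (τ.act_one x)
  map_mul' g h := by
    apply LinearMap.ext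
    rintro ⟨x⟩
    exact congrArg Submodule.Quotient.mk (τ.act_mul g h x)

end

end SkewAction

/-! ### The functor from modules over the invariant ring to representations -/

section Auslander

variable (k S G : Type*) [Field k] [CommRing S] [Algebra k S] [Group G]
  [MulSemiringAction G S] [SMulCommClass G k S]
  (N : Type*) [AddCommGroup N] [Module (InvariantRing k S G) N]

/-- The action of `S * G` on `S ⊗_R N`, where `R = S ^ G`: `g (s ⊗ x) = g(s) ⊗ x`. -/
noncomputable def baseChangeAction : SkewAction G S (S ⊗[InvariantRing k S G] N) where
  act g := (LinearMap.rTensor N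
    (MulSemiringAction.toAlgHom (InvariantRing k S G) S g).toLinearMap).toAddMonoidHom
  act_one x := by
    induction x with
    | zero => simp
    | tmul s x => simp
    | add x y hx hy => rw [map_add, hx, hy]
  act_mul g h x := by
    induction x with
    | zero => simp
    | tmul s x => simp [mul_smul]
    | add x y hx hy => rw [map_add, hx, hy, map_add, map_add]
  act_smul g s x := by
    induction x with
    | zero => simp
    | tmul t x => simp [TensorProduct.smul_tmul', smul_mul']
    | add x y hx hy => rw [smul_add, map_add, hx, hy, map_add, smul_add]

/-- The `S`-module `(S ⊗_R N)**`, where `R = S ^ G` and `(-)* = Hom_S(-, S)`. -/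
abbrev ReflexiveBaseChange : Type _ :=
  Module.Dual S (Module.Dual S (S ⊗[InvariantRing k S G] N))

/-- The representation `𝒜'(N) = (S ⊗_R N)** ⊗_S S/𝔪` of `G` over `k` which corresponds to the module
`N` over the invariant ring `R = S ^ G` of the local ring `(S, 𝔪)`. -/
noncomputable def auslanderRep [IsLocalRing S] :
    Representation k G (ReflexiveBaseChange k S G N ⧸
      (IsLocalRing.maximalIdeal S • (⊤ : Submodule S (ReflexiveBaseChange k S G N)))) :=
  (baseChangeAction k S G N).dual.dual.residueRep k

end Auslander

/-! Write `R = S^G`, `N ⊆ R^b` for the second syzygy and `X = (S ⊗_R N)**`. The coordinates of `R^b`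
induce `S`-linear, `G`-equivariant maps `X → S` (`coordEval_act`). Their images lie in `𝔪_S`: traces
of the coordinates of an element of `X` form a vector of `N`, which minimality puts in `𝔪_R R^b`
(`MinimalFreeResolution.invariantTrace_coordEval_mem`), and the trace multiplies constant terms by
`n ≠ 0`. If `g` is trivial on `X/𝔪_S X`, it therefore fixes every coordinate `z` of an element of
`X` modulo `𝔪_S²` (`smul_coordEval_sub_mem_sq`).

It remains to find a coordinate with a `v`-term: if `g = diag(c, c^a)`, this forces `c^a = 1`, and
with `c^n = 1` and `gcd(a, n) = 1` it gives `c = 1`. Take `A = u^n`, `B = u^i v` invariant with `0 <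
i < n`, and let `f` lift `1` from the residue field, `A f = d p`, `B f = d q`. As `A ∉ 𝔪_R²`, some
coordinate of `p` is a unit (`exists_isUnit_of_d_eq_smul`). The syzygy `B p - A q` becomes divisible
by `u^i` in `X` (`exists_mul_coordEval_eq`), and the quotient has a coordinate `v r - u^(n-i) r'`
with `r` a unit. -/

namespace MvPowerSeries

/-! ### Divisibility and linear terms of power series. -/

theorem X_pow_dvd_of_dvd_X_pow_mul {σ R : Type*} [CommSemiring R] {s t : σ} (hst : s ≠ t) {i j : ℕ}
    {f : MvPowerSeries σ R} (h : (X s : MvPowerSeries σ R) ^ i ∣ X t ^ j * f) :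
    (X s : MvPowerSeries σ R) ^ i ∣ f := by
  classical
  rw [X_pow_dvd_iff] at h ⊢
  -- Multiplying by `X t ^ j` shifts exponents in the `t` direction only, so the exponent of `s`
  -- stays below `i`.
  intro m hm
  have := h (Finsupp.single t j + m) (by simpa [hst] using hm)
  rwa [X_pow_eq, coeff_add_monomial_mul, one_mul] at this

theorem mem_maximalIdeal_iff {σ k : Type*} [Field k] {f : MvPowerSeries σ k} :
    f ∈ IsLocalRing.maximalIdeal (MvPowerSeries σ k) ↔ constantCoeff f = 0 := by
  rw [IsLocalRing.mem_maximalIdeal, mem_nonunits_iff, isUnit_iff_constantCoeff, isUnit_iff_ne_zero,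
    not_not]

/-- A product of two power series without constant term has no linear term. -/
theorem coeff_single_one_mul_eq_zero {σ R : Type*} [CommSemiring R] {f g : MvPowerSeries σ R}
    (hf : constantCoeff f = 0) (hg : constantCoeff g = 0) (s : σ) :
    coeff (Finsupp.single s 1) (f * g) = 0 := by
  classical
  rw [coeff_mul]
  refine Finset.sum_eq_zero fun x hx => ?_
  rw [Finsupp.antidiagonal_single, Finset.mem_map] at hx
  obtain ⟨⟨b, c⟩, hbc, rfl⟩ := hx
  rw [Finset.HasAntidiagonal.mem_antidiagonal] at hbc
  dsimp at hbc
  obtain ⟨rfl, rfl⟩ | ⟨rfl, rfl⟩ : (b = 0 ∧ c = 1) ∨ (b = 1 ∧ c = 0) := by omega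
  · simp [hf]
  · simp [hg]

theorem coeff_single_one_eq_zero_of_mem_maximalIdeal_sq {σ k : Type*} [Field k]
    {f : MvPowerSeries σ k}
    (hf : f ∈ IsLocalRing.maximalIdeal (MvPowerSeries σ k) * IsLocalRing.maximalIdeal _) (s : σ) :
    coeff (Finsupp.single s 1) f = 0 := by
  induction hf using Submodule.mul_induction_on' with
  | mem_mul_mem f hf g hg =>
    exact coeff_single_one_mul_eq_zero (mem_maximalIdeal_iff.1 hf) (mem_maximalIdeal_iff.1 hg) s
  | add f _ g _ hf hg => rw [map_add, hf, hg, add_zero]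

theorem coeff_X_one_mul_sub {k : Type*} [Field k] {i : ℕ} (hi : 0 < i)
    (f g : MvPowerSeries (Fin 2) k) :
    coeff (Finsupp.single 1 1) (X 1 * f - X 0 ^ i * g) = constantCoeff f := by
  have h0 : coeff (Finsupp.single 1 1) (X 0 ^ i * g) = 0 :=
    X_pow_dvd_iff.1 (dvd_mul_right _ _) _ (by simpa using hi)
  have h1 := coeff_add_monomial_mul (Finsupp.single 1 1) 0 f 1
  rw [map_sub, h0, sub_zero]
  simpa [X] using h1

end MvPowerSeries

/-- The inverse in `S` of an invariant element is itself invariant, by cancellation. -/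
theorem InvariantRing.isUnit_of_isUnit_coe {k S G : Type*} [CommRing k] [CommRing S] [Algebra k S]
    [Group G] [MulSemiringAction G S] [SMulCommClass G k S] {x : InvariantRing k S G}
    (hx : IsUnit (x : S)) : IsUnit x := by
  obtain ⟨y, hy⟩ := hx.exists_right_inv
  refine IsUnit.of_mul_eq_one (⟨y, fun g => hx.mul_left_cancel ?_⟩ : InvariantRing k S G)
    (Subtype.ext hy)
  have h : g • ((x : S) * y) = x * y := by rw [hy, smul_one]
  rwa [smul_mul', x.2 g] at h

/-! ### The diagonal action on monomials. -/

namespace cyclicGroup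

open MvPowerSeries

variable {k : Type*} [Field k] {ξ : kˣ} {a n : ℕ}

variable (k a) in
/-- The homomorphism sending `c` to the diagonal matrix with entries `c, c ^ a`. -/
def diagonalHom : kˣ →* GL (Fin 2) k where
  toFun c := ⟨Matrix.diagonal ![(c : k), (c : k) ^ a],
    Matrix.diagonal ![((c⁻¹ : kˣ) : k), ((c⁻¹ : kˣ) : k) ^ a],
    by simp [Matrix.one_fin_two, Matrix.diagonal_fin_two],
    by simp [Matrix.one_fin_two, Matrix.diagonal_fin_two]⟩
  map_one' := Units.ext (by simp [Matrix.one_fin_two, Matrix.diagonal_fin_two])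
  map_mul' c d := Units.ext (by simp [Matrix.diagonal_fin_two, mul_pow])

theorem val_diagonalHom (c : kˣ) :
    (diagonalHom k a c).1 = Matrix.diagonal ![(c : k), (c : k) ^ a] := rfl

theorem diagonalHom_injective : Function.Injective (diagonalHom k a) := fun c d h => by
  have := congrArg (fun A : GL (Fin 2) k => A.1 0 0) h
  exact Units.ext (by simpa [val_diagonalHom] using this)

theorem eq_zpowers (ξ : kˣ) (a : ℕ) :
    cyclicGroup ξ a = Subgroup.zpowers (diagonalHom k a ξ) := by
  rw [cyclicGroup]
  congr 1
  exact Units.ext rfl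

theorem exists_eq_zpow (g : cyclicGroup ξ a) :
    ∃ j : ℤ, (g : GL (Fin 2) k) = diagonalHom k a (ξ ^ j) := by
  obtain ⟨g, hg⟩ := g
  rw [eq_zpowers] at hg
  obtain ⟨j, rfl⟩ := hg
  exact ⟨j, (map_zpow _ _ _).symm⟩

/-- A diagonal matrix rescales the variables, so monomials are eigenvectors, of weight `m 0 + a * m
1`. -/
theorem coeff_smul_of_eq_diagonalHom {g : cyclicGroup ξ a} {c : kˣ}
    (hg : (g : GL (Fin 2) k) = diagonalHom k a c)
    (f : MvPowerSeries (Fin 2) k) (m : Fin 2 →₀ ℕ) :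
    coeff m (g • f) = (c : k) ^ (m 0 + a * m 1) * coeff m f := by
  have h : g • f = rescale ![(c : k), (c : k) ^ a] f := by
    rw [rescale_eq_subst]
    change subst (LinearAction.form (g : GL (Fin 2) k).1) f = _
    congr 1
    funext j
    rw [hg, val_diagonalHom]
    fin_cases j <;> simp [LinearAction.form]
  rw [h, coeff_rescale, Finsupp.prod_fintype _ _ (by simp)]
  simp [pow_add, pow_mul]

theorem constantCoeff_smul (g : cyclicGroup ξ a) (f : MvPowerSeries (Fin 2) k) :
    constantCoeff (g • f) = constantCoeff f := by
  obtain ⟨j, hj⟩ := exists_eq_zpow g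
  rw [← coeff_zero_eq_constantCoeff_apply, coeff_smul_of_eq_diagonalHom hj]
  simp

theorem card_eq (hξ : IsPrimitiveRoot ξ n) : Nat.card (cyclicGroup ξ a) = n := by
  rw [eq_zpowers, Nat.card_zpowers, orderOf_injective _ diagonalHom_injective, hξ.eq_orderOf]

theorem monomial_mem_invariantRing (hξ : IsPrimitiveRoot ξ n) {s t : ℕ} (h : n ∣ s + a * t) :
    (X 0 ^ s * X 1 ^ t : MvPowerSeries (Fin 2) k) ∈
      InvariantRing k (MvPowerSeries (Fin 2) k) (cyclicGroup ξ a) := by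
  intro g
  obtain ⟨j, hj⟩ := exists_eq_zpow g
  ext m
  rw [coeff_smul_of_eq_diagonalHom hj, X_pow_eq, X_pow_eq, monomial_mul_monomial, coeff_monomial]
  split_ifs with hm
  · subst hm
    obtain ⟨d, hd⟩ := h
    have : ((ξ ^ j) ^ (n * d) : kˣ) = 1 := by
      rw [← zpow_natCast, ← zpow_mul, mul_comm, zpow_mul, zpow_natCast, pow_mul, hξ.pow_eq_one,
        one_pow, one_zpow]
    have := congrArg Units.val this
    simpa [hd] using this
  · simp

/-- Comparing coefficients under the generator forces `ξ` to the weight of `m` to be `1`. -/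
theorem dvd_of_coeff_ne_zero (hξ : IsPrimitiveRoot ξ n)
    (f : InvariantRing k (MvPowerSeries (Fin 2) k) (cyclicGroup ξ a)) {m : Fin 2 →₀ ℕ}
    (hm : coeff m (f : MvPowerSeries (Fin 2) k) ≠ 0) : n ∣ m 0 + a * m 1 := by
  have h := congrArg (coeff m) (f.2 ⟨diagonalHom k a ξ, by
    rw [eq_zpowers]
    exact Subgroup.mem_zpowers _⟩)
  rw [coeff_smul_of_eq_diagonalHom (c := ξ) rfl] at h
  rw [← IsPrimitiveRoot.pow_eq_one_iff_dvd hξ]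
  ext
  push_cast
  exact mul_right_cancel₀ hm (h.trans (one_mul _).symm)

end cyclicGroup

/-! ### Coordinates on the reflexive base change, and the trace. -/

theorem Submodule.mem_smul_top_pi_iff {R ι : Type*} [CommRing R] [Finite ι] {I : Ideal R}
    {x : ι → R} : x ∈ I • (⊤ : Submodule R (ι → R)) ↔ ∀ i, x i ∈ I := by
  classical
  have := Fintype.ofFinite ι
  refine ⟨fun hx i => ?_, fun hx => ?_⟩
  · induction hx using Submodule.smul_induction_on' with
    | smul r hr y _ => exact I.mul_mem_right _ hr
    | add y _ z _ hy hz => exact I.add_mem hy hz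
  · rw [pi_eq_sum_univ x]
    exact Submodule.sum_mem _ fun i _ => Submodule.smul_mem_smul (hx i) Submodule.mem_top

/-- The `j`-th coordinate `s ⊗ x ↦ s x_j` on `S ⊗_R N`, for a submodule `N` of `R ^ ι`. -/
noncomputable def coordDual {R ι : Type*} (S : Type*) [CommRing R] [CommRing S] [Algebra R S]
    (N : Submodule R (ι → R)) (j : ι) : Module.Dual S (S ⊗[R] N) :=
  (Algebra.linearMap R S ∘ₗ LinearMap.proj j ∘ₗ N.subtype).liftBaseChange S

@[simp]
theorem coordDual_tmul {R S ι : Type*} [CommRing R] [CommRing S] [Algebra R S]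
    (N : Submodule R (ι → R)) (j : ι) (s : S) (x : N) :
    coordDual S N j (s ⊗ₜ x) = s * algebraMap R S (x.1 j) := rfl

section

variable {k S G ι : Type*} [Field k] [CommRing S] [Algebra k S] [Group G]
  [MulSemiringAction G S] [SMulCommClass G k S]

/-- A shortcut that spares the search through the subring structures on `S`. -/
local instance {ι : Type*} (N : Submodule (InvariantRing k S G) (ι → InvariantRing k S G)) :
    Module (InvariantRing k S G) N := N.module

/-- On `1 ⊗ x` a coordinate takes values in `R`, which `G` fixes; this makes `coordEval`
equivariant. -/
theorem baseChangeAction_dual_act_coordDual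
    (N : Submodule (InvariantRing k S G) (ι → InvariantRing k S G)) (g : G) (j : ι) :
    (baseChangeAction k S G N).dual.act g (coordDual S N j) = coordDual S N j := by
  ext x
  change g • coordDual S N j (((MulSemiringAction.toAlgHom (InvariantRing k S G) S g⁻¹) 1) ⊗ₜ x) =
    coordDual S N j (1 ⊗ₜ x)
  rw [map_one, coordDual_tmul, one_mul]
  exact (x.1 j).2 g

/-- The map `(S ⊗_R N)** → S` induced by the `j`-th coordinate, for a submodule `N` of `R ^ ι`. -/
noncomputable def coordEval (N : Submodule (InvariantRing k S G) (ι → InvariantRing k S G))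
    (j : ι) : ReflexiveBaseChange k S G N →ₗ[S] S :=
  Module.Dual.eval S _ (coordDual S N j)

theorem coordEval_act (N : Submodule (InvariantRing k S G) (ι → InvariantRing k S G)) (g : G)
    (w : ReflexiveBaseChange k S G N) (j : ι) :
    coordEval N j ((baseChangeAction k S G N).dual.dual.act g w) = g • coordEval N j w := by
  change g • w ((baseChangeAction k S G N).dual.act g⁻¹ (coordDual S N j)) = _
  rw [baseChangeAction_dual_act_coordDual]
  rfl

variable (k G) in
/-- The trace `s ↦ ∑ g, g s`. -/
noncomputable def invariantTrace [Fintype G] : S →ₗ[InvariantRing k S G] InvariantRing k S G where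
  toFun s := ⟨∑ g : G, g • s, fun h => by
    rw [Finset.smul_sum]
    exact Fintype.sum_equiv (Equiv.mulLeft h) _ _ (fun g => by simp [mul_smul])⟩
  map_add' x y := by ext; simp [Finset.sum_add_distrib]
  map_smul' r x := by
    ext
    have : ∀ g : G, g • (r • x) = r • (g • x) := fun g => smul_comm g r x
    simp only [this, ← Finset.smul_sum, RingHom.id_apply]
    rfl

theorem coe_invariantTrace [Fintype G] (s : S) :
    (invariantTrace k G s : S) = ∑ g : G, g • s := rfl

variable [IsLocalRing S] {M : Type*} [AddCommGroup M] [Module (InvariantRing k S G) M]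

/-- An element of `(S ⊗_R N)**` for a second syzygy module `N` in `R ^ b` has image in `S ^ b` whose
coordinates have traces in the maximal ideal of `R`. -/
theorem MinimalFreeResolution.invariantTrace_coordEval_mem [Fintype G]
    (F : MinimalFreeResolution (InvariantRing k S G) M)
    (x : ReflexiveBaseChange k S G F.secondSyzygy) (j : Fin (F.b 1)) :
    invariantTrace k G (coordEval F.secondSyzygy j x) ∈
      IsLocalRing.maximalIdeal (InvariantRing k S G) := by
  let R := InvariantRing k S G
  let y : Fin (F.b 1) → R := fun j => invariantTrace k G (x (coordDual S F.secondSyzygy j))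
  have hy : y ∈ LinearMap.ker (F.d 0) := by
    have hd : ∀ (z : Fin (F.b 1) → R) t, F.d 0 z t = ∑ j, z j * F.d 0 (Pi.single j 1) t := by
      intro z t
      conv_lhs => rw [← (Pi.basisFun R _).sum_repr z]
      simp
    rw [LinearMap.mem_ker]
    funext t
    -- The equations cutting out `ker (F.d 0)` are linear relations among the coordinate
    -- functionals, so `x` preserves them; the `R`-linear trace then carries them from `S` down to
    -- `R`.
    have h0 : ∑ j, algebraMap R S (F.d 0 (Pi.single j 1) t) • coordDual S F.secondSyzygy j = 0 := by
      ext z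
      have hz := congrArg (algebraMap R S) ((hd z.1 t).symm.trans (congrFun z.2 t))
      simpa [mul_comm] using hz
    have h1 := congrArg x h0
    rw [map_sum, map_zero] at h1
    have h2 := congrArg (invariantTrace k G) h1
    simp only [map_sum, algebraMap_smul, map_zero] at h2
    rw [hd]
    simpa [y, mul_comm] using h2
  rw [← F.exact_succ 0] at hy
  exact Submodule.mem_smul_top_pi_iff.1 (F.minimal 1 hy) j

end

/-! ### The maximal ideals of `S` and `R` through constant terms. -/

namespace cyclicGroup

open MvPowerSeries

variable {k : Type*} [Field k] {ξ : kˣ} {a n : ℕ}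

theorem constantCoeff_eq_zero_of_mem_maximalIdeal
    {r : InvariantRing k (MvPowerSeries (Fin 2) k) (cyclicGroup ξ a)}
    (hr : r ∈ IsLocalRing.maximalIdeal _) : constantCoeff (r : MvPowerSeries (Fin 2) k) = 0 := by
  by_contra h
  exact (IsLocalRing.mem_maximalIdeal _).1 hr (InvariantRing.isUnit_of_isUnit_coe
    (isUnit_iff_constantCoeff.2 (isUnit_iff_ne_zero.2 h)))

theorem mem_maximalIdeal_of_constantCoeff_eq_zero
    {r : InvariantRing k (MvPowerSeries (Fin 2) k) (cyclicGroup ξ a)}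
    (hr : constantCoeff (r : MvPowerSeries (Fin 2) k) = 0) :
    r ∈ IsLocalRing.maximalIdeal (InvariantRing k (MvPowerSeries (Fin 2) k) (cyclicGroup ξ a)) := by
  refine (IsLocalRing.mem_maximalIdeal _).2 fun h => ?_
  have := (h.map (InvariantRing k (MvPowerSeries (Fin 2) k) (cyclicGroup ξ a)).val).map
    (constantCoeff (σ := Fin 2) (R := k))
  exact this.ne_zero hr

/-- Pure powers of `u` in an invariant series have exponents divisible by `n`. Without constant
terms, a product of two such series has pure `u`-powers only from `u^(2n)` on. This gives `u^n ∉
𝔪_R²`. -/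
theorem coeff_eq_zero_of_mem_maximalIdeal_sq (hξ : IsPrimitiveRoot ξ n)
    {r : InvariantRing k (MvPowerSeries (Fin 2) k) (cyclicGroup ξ a)}
    (hr : r ∈ IsLocalRing.maximalIdeal (InvariantRing k (MvPowerSeries (Fin 2) k)
      (cyclicGroup ξ a)) * IsLocalRing.maximalIdeal _) :
    coeff (Finsupp.single 0 n) (r : MvPowerSeries (Fin 2) k) = 0 := by
  classical
  induction hr using Submodule.mul_induction_on' with
  | mem_mul_mem f hf g hg =>
    replace hf := constantCoeff_eq_zero_of_mem_maximalIdeal hf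
    replace hg := constantCoeff_eq_zero_of_mem_maximalIdeal hg
    change coeff _ ((f : MvPowerSeries (Fin 2) k) * (g : MvPowerSeries (Fin 2) k)) = 0
    rw [coeff_mul]
    refine Finset.sum_eq_zero fun x hx => ?_
    rw [Finsupp.antidiagonal_single, Finset.mem_map] at hx
    obtain ⟨⟨b, c⟩, hbc, rfl⟩ := hx
    rw [Finset.HasAntidiagonal.mem_antidiagonal] at hbc
    dsimp at hbc
    by_contra hne
    have hb := dvd_of_coeff_ne_zero hξ f (left_ne_zero_of_mul hne)
    have hc := dvd_of_coeff_ne_zero hξ g (right_ne_zero_of_mul hne)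
    simp only [Function.Embedding.prodMap, Function.Embedding.coeFn_mk, Prod.map,
      Finsupp.single_eq_same, Finsupp.single_eq_of_ne (show (1 : Fin 2) ≠ 0 by decide), mul_zero,
      add_zero] at hb hc
    rcases Nat.eq_zero_or_pos b with rfl | hb0
    · exact left_ne_zero_of_mul hne (by simpa using hf)
    rcases Nat.eq_zero_or_pos c with rfl | hc0
    · exact right_ne_zero_of_mul hne (by simpa using hg)
    have := Nat.le_of_dvd hb0 hb
    have := Nat.le_of_dvd hc0 hc
    omega
  | add f _ g _ hf hg =>
    change coeff _ ((f : MvPowerSeries (Fin 2) k) + (g : MvPowerSeries (Fin 2) k)) = 0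
    rw [map_add, hf, hg, add_zero]

/-- `G` fixes constant terms, so the trace multiplies them by `|G| = n`, which is nonzero in `k`. -/
theorem mem_maximalIdeal_of_invariantTrace_mem [Fintype (cyclicGroup ξ a)]
    (hξ : IsPrimitiveRoot ξ n) (hn : (n : k) ≠ 0) {s : MvPowerSeries (Fin 2) k}
    (hs : invariantTrace k (cyclicGroup ξ a) s ∈ IsLocalRing.maximalIdeal _) :
    s ∈ IsLocalRing.maximalIdeal (MvPowerSeries (Fin 2) k) := by
  have h := constantCoeff_eq_zero_of_mem_maximalIdeal hs
  rw [coe_invariantTrace, map_sum] at h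
  simp only [constantCoeff_smul, Finset.sum_const, Finset.card_univ, ← Nat.card_eq_fintype_card,
    card_eq hξ, nsmul_eq_mul] at h
  exact mem_maximalIdeal_iff.2 ((mul_eq_zero.1 h).resolve_left hn)

end cyclicGroup

/-! ### Division in the double dual; the free cover of the residue field. -/

/-- If `φ(t)` is divisible by `α` for every linear form `φ`, then `t / α` makes sense in the double
dual. -/
theorem Module.Dual.exists_mul_eq_apply {S T : Type*} [CommRing S] [IsDomain S] [AddCommGroup T]
    [Module S T] {α : S} (hα : α ≠ 0) {t : T} (h : ∀ φ : Module.Dual S T, α ∣ φ t) :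
    ∃ w : Module.Dual S (Module.Dual S T), ∀ φ, α * w φ = φ t := by
  choose w hw using h
  refine ⟨{ toFun := w, map_add' := fun φ ψ => ?_, map_smul' := fun s φ => ?_ },
    fun φ => (hw φ).symm⟩
  · refine mul_left_cancel₀ hα ?_
    rw [mul_add, ← hw, ← hw, ← hw, LinearMap.add_apply]
  · refine mul_left_cancel₀ hα ?_
    rw [← hw, LinearMap.smul_apply, hw φ, RingHom.id_apply, smul_eq_mul, smul_eq_mul,
      mul_left_comm]

namespace MinimalFreeResolution

variable {R : Type*} [CommRing R] [IsLocalRing R]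
  (F : MinimalFreeResolution R (IsLocalRing.ResidueField R))

/-- A generator `f` of the free cover of the residue field: it spans a free direct summand, and
`r f` is a boundary for `r` in the maximal ideal. -/
theorem exists_isUnit_apply_and_smul_mem_range : ∃ f : Fin (F.b 0) → R, (∃ t, IsUnit (f t)) ∧
    ∀ r ∈ IsLocalRing.maximalIdeal R, r • f ∈ LinearMap.range (F.d 0) := by
  obtain ⟨f, hf⟩ := F.surjective 1
  have hε : ∀ r ∈ IsLocalRing.maximalIdeal R, ∀ y : IsLocalRing.ResidueField R, r • y = 0 := by
    intro r hr y
    rw [Algebra.smul_def, IsLocalRing.ResidueField.algebraMap_eq,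
      (IsLocalRing.residue_eq_zero_iff r).2 hr, zero_mul]
  refine ⟨f, ?_, fun r hr => ?_⟩
  · by_contra! h
    -- Without a unit coordinate, `f` would lie in `𝔪 R^b`, which `ε` kills, although `ε f = 1`.
    have hmem : f ∈ IsLocalRing.maximalIdeal R • (⊤ : Submodule R (Fin (F.b 0) → R)) :=
      Submodule.mem_smul_top_pi_iff.2 fun t => (IsLocalRing.mem_maximalIdeal _).2 (h t)
    have h0 : F.ε f = 0 := by
      clear hf h
      induction hmem using Submodule.smul_induction_on' with
      | smul r hr y _ => rw [map_smul, hε r hr]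
      | add y _ z _ hy hz => rw [map_add, hy, hz, add_zero]
    exact one_ne_zero (hf.symm.trans h0)
  · rw [F.exact_zero, LinearMap.mem_ker, map_smul, hε r hr]

/-- Otherwise `p ∈ 𝔪 R^b`, and minimality of `d` gives `d p ∈ 𝔪² R^b`; the coordinate `t`, where `f`
is a unit, would put `r` in `𝔪²`. -/
theorem exists_isUnit_of_d_eq_smul {p : Fin (F.b 1) → R} {r : R} {f : Fin (F.b 0) → R} {t}
    (ht : IsUnit (f t)) (hp : F.d 0 p = r • f)
    (hr : r ∉ IsLocalRing.maximalIdeal R * IsLocalRing.maximalIdeal R) : ∃ l, IsUnit (p l) := by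
  by_contra! h
  have hmem : p ∈ IsLocalRing.maximalIdeal R • (⊤ : Submodule R (Fin (F.b 1) → R)) :=
    Submodule.mem_smul_top_pi_iff.2 fun t => (IsLocalRing.mem_maximalIdeal _).2 (h t)
  have h1 := Submodule.mem_map_of_mem (f := F.d 0) hmem
  rw [Submodule.map_smul'', Submodule.map_top, hp] at h1
  have h2 := Submodule.smul_mono le_rfl (F.minimal 0) h1
  rw [← Submodule.mul_smul] at h2
  exact hr ((Ideal.mul_unit_mem_iff_mem _ ht).1 (Submodule.mem_smul_top_pi_iff.1 h2 t))

end MinimalFreeResolution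

/-! ### Dividing a syzygy, and the action modulo `𝔪_S²`. -/

section

variable {k S G : Type*} [Field k] [CommRing S] [Algebra k S] [Group G] [MulSemiringAction G S]
  [SMulCommClass G k S]

/-- A shortcut that spares the search through the subring structures on `S`. -/
local instance {ι : Type*} (N : Submodule (InvariantRing k S G) (ι → InvariantRing k S G)) :
    Module (InvariantRing k S G) N := N.module

theorem SkewAction.act_sub_mem_of_residueRep_eq_one [IsLocalRing S] {X : Type*} [AddCommGroup X]
    [Module S X] [Module k X] [IsScalarTower k S X] {τ : SkewAction G S X} {g : G}
    (hg : τ.residueRep k g = 1) (x : X) :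
    τ.act g x - x ∈ IsLocalRing.maximalIdeal S • (⊤ : Submodule S X) :=
  (Submodule.Quotient.eq _).1 (LinearMap.congr_fun hg (Submodule.Quotient.mk x))

/-- Suppose `d p = A f`, `d q = B f` and `C A = D B` in `R`, and that `α` divides `s` in `S` as soon
as `B` divides `C s`. Then the syzygy `(B p - A q) / α` defines an element of `(S ⊗_R ker d)**`. -/
theorem exists_mul_coordEval_eq [IsDomain S] {M : Type*} [AddCommGroup M]
    [Module (InvariantRing k S G) M] [IsLocalRing S]
    (F : MinimalFreeResolution (InvariantRing k S G) M)
    {p q : Fin (F.b 1) → InvariantRing k S G} {f : Fin (F.b 0) → InvariantRing k S G}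
    {A B C D : InvariantRing k S G}
    (hp : F.d 0 p = A • f) (hq : F.d 0 q = B • f) (hCA : C * A = D * B) {α : S} (hα : α ≠ 0)
    (hdvd : ∀ s s' : S, (C : S) * s = (B : S) * s' → α ∣ s) :
    ∃ w : ReflexiveBaseChange k S G F.secondSyzygy, ∀ l,
      α * coordEval F.secondSyzygy l w = (B : S) * (p l : S) - (A : S) * (q l : S) := by
  let x : F.secondSyzygy := ⟨B • p - A • q, by
    change F.d 0 _ = 0
    rw [map_sub, map_smul, map_smul, hp, hq, smul_comm, sub_self]⟩
  -- A companion syzygy with `C x = B y`: every functional then satisfies `C φ(x) = B φ(y)`, so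
  -- `hdvd` makes `φ(x)` divisible by `α`.
  let y : F.secondSyzygy := ⟨C • p - D • q, by
    change F.d 0 _ = 0
    rw [map_sub, map_smul, map_smul, hp, hq, smul_smul, smul_smul, hCA, sub_self]⟩
  have hxy : C • x = B • y := by
    apply Subtype.ext
    change C • (B • p - A • q) = B • (C • p - D • q)
    rw [smul_sub, smul_sub, smul_smul, smul_smul, smul_smul, smul_smul, hCA, mul_comm C B,
      mul_comm D B]
  have h : ∀ φ : Module.Dual S (S ⊗[InvariantRing k S G] F.secondSyzygy), α ∣ φ (1 ⊗ₜ x) := by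
    intro φ
    refine hdvd _ (φ (1 ⊗ₜ y)) ?_
    have h1 : (C : S) • ((1 : S) ⊗ₜ[InvariantRing k S G] x) =
        (B : S) • ((1 : S) ⊗ₜ[InvariantRing k S G] y) := by
      change C • ((1 : S) ⊗ₜ[InvariantRing k S G] x) = B • ((1 : S) ⊗ₜ[InvariantRing k S G] y)
      exact (TensorProduct.tmul_smul C (1 : S) x).symm.trans
        ((congrArg _ hxy).trans (TensorProduct.tmul_smul B (1 : S) y))
    rw [← smul_eq_mul, ← smul_eq_mul, ← map_smul, ← map_smul, h1]
  obtain ⟨w, hw⟩ := Module.Dual.exists_mul_eq_apply hα h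
  exact ⟨w, fun l => (hw (coordDual S F.secondSyzygy l)).trans (one_mul _)⟩

/-- Triviality on the quotient puts `g w - w` in `𝔪_S X`; a coordinate map is linear with image in
`𝔪_S`, which supplies the second factor. -/
theorem smul_coordEval_sub_mem_sq [IsLocalRing S] [Fintype G] {M : Type*} [AddCommGroup M]
    [Module (InvariantRing k S G) M]
    (htr : ∀ s : S, invariantTrace k G s ∈ IsLocalRing.maximalIdeal (InvariantRing k S G) →
      s ∈ IsLocalRing.maximalIdeal S)
    (F : MinimalFreeResolution (InvariantRing k S G) M) {g : G}
    (hg : auslanderRep k S G F.secondSyzygy g = 1)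
    (w : ReflexiveBaseChange k S G F.secondSyzygy) (l : Fin (F.b 1)) :
    g • coordEval F.secondSyzygy l w - coordEval F.secondSyzygy l w ∈
      IsLocalRing.maximalIdeal S * IsLocalRing.maximalIdeal S := by
  have hmem := SkewAction.act_sub_mem_of_residueRep_eq_one hg w
  rw [← coordEval_act, ← map_sub]
  generalize (baseChangeAction k S G F.secondSyzygy).dual.dual.act g w - w = x at hmem ⊢
  induction hmem using Submodule.smul_induction_on' with
  | smul r hr x _ =>
    rw [map_smul, smul_eq_mul]
    exact Ideal.mul_mem_mul hr (htr _ (F.invariantTrace_coordEval_mem x l))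
  | add x _ y _ hx hy =>
    rw [map_add]
    exact Ideal.add_mem _ hx hy

/-- If `A`, `B` are in the maximal ideal of `R = S ^ G`, with `A` outside of its square, and `α` is
as in `exists_mul_coordEval_eq`, then there is a syzygy with a coordinate of the form
`(B r - A r') / α` for a unit `r`. -/
theorem exists_isUnit_mul_coordEval_eq [IsDomain S] [IsLocalRing S]
    (F : MinimalFreeResolution (InvariantRing k S G)
      (IsLocalRing.ResidueField (InvariantRing k S G)))
    {A B C D : InvariantRing k S G} (hA : A ∈ IsLocalRing.maximalIdeal (InvariantRing k S G))
    (hA' : A ∉ IsLocalRing.maximalIdeal (InvariantRing k S G) *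
      IsLocalRing.maximalIdeal (InvariantRing k S G))
    (hB : B ∈ IsLocalRing.maximalIdeal (InvariantRing k S G))
    (hCA : C * A = D * B) {α : S} (hα : α ≠ 0)
    (hdvd : ∀ s s' : S, (C : S) * s = (B : S) * s' → α ∣ s) :
    ∃ (l : Fin (F.b 1)) (r r' : InvariantRing k S G)
      (w : ReflexiveBaseChange k S G F.secondSyzygy), IsUnit r ∧
      α * coordEval F.secondSyzygy l w = (B : S) * (r : S) - (A : S) * (r' : S) := by
  obtain ⟨f, ⟨t, ht⟩, hf⟩ := F.exists_isUnit_apply_and_smul_mem_range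
  obtain ⟨p, hp⟩ := hf A hA
  obtain ⟨q, hq⟩ := hf B hB
  obtain ⟨l, hl⟩ := F.exists_isUnit_of_d_eq_smul ht hp hA'
  obtain ⟨w, hw⟩ := exists_mul_coordEval_eq F hp hq hCA hα hdvd
  exact ⟨l, p l, q l, w, hl, hw l⟩

/-- Let `A`, `B` be in the maximal ideal of `R = S ^ G`, with `A` outside of its square, and let `α`
be as in `exists_mul_coordEval_eq`. Then there is a syzygy of the form `z = (B r - A r') / α` with
`r` a unit whose class is invariant, modulo the square of the maximal ideal of `S`, under the kernel
of the representation associated with the second syzygy of the residue field. -/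
theorem exists_smul_sub_mem_sq [IsDomain S] [IsLocalRing S] [Fintype G]
    (htr : ∀ s : S, invariantTrace k G s ∈ IsLocalRing.maximalIdeal (InvariantRing k S G) →
      s ∈ IsLocalRing.maximalIdeal S)
    (F : MinimalFreeResolution (InvariantRing k S G)
      (IsLocalRing.ResidueField (InvariantRing k S G)))
    {A B C D : InvariantRing k S G} (hA : A ∈ IsLocalRing.maximalIdeal (InvariantRing k S G))
    (hA' : A ∉ IsLocalRing.maximalIdeal (InvariantRing k S G) *
      IsLocalRing.maximalIdeal (InvariantRing k S G))
    (hB : B ∈ IsLocalRing.maximalIdeal (InvariantRing k S G))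
    (hCA : C * A = D * B) {α : S} (hα : α ≠ 0)
    (hdvd : ∀ s s' : S, (C : S) * s = (B : S) * s' → α ∣ s) :
    ∃ (r r' : InvariantRing k S G) (z : S), IsUnit r ∧
      α * z = (B : S) * (r : S) - (A : S) * (r' : S) ∧
      ∀ g, auslanderRep k S G F.secondSyzygy g = 1 →
        g • z - z ∈ IsLocalRing.maximalIdeal S * IsLocalRing.maximalIdeal S :=
  (exists_isUnit_mul_coordEval_eq F hA hA' hB hCA hα hdvd).elim fun l h =>
    h.imp fun _ h => h.imp fun _ h => h.elim fun w h =>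
      ⟨coordEval F.secondSyzygy l w, h.1, h.2, fun _ hg => smul_coordEval_sub_mem_sq htr F hg w l⟩

end

/-! ### The choice of monomials, and the conclusion. -/

namespace cyclicGroup

open MvPowerSeries

variable {k : Type*} [Field k] {ξ : kˣ} {a n : ℕ}

/-- `i` represents `-a` modulo `n`; it is not `0` because `a` is prime to `n ≥ 2`. -/
theorem exists_lt_dvd_add (hn : 2 ≤ n) (han : Nat.Coprime a n) :
    ∃ i, 0 < i ∧ i < n ∧ n ∣ i + a := by
  have h1 : a % n < n := Nat.mod_lt _ (by omega)
  have h2 : a % n ≠ 0 := fun h => by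
    have := Nat.eq_one_of_dvd_coprimes han (Nat.dvd_of_mod_eq_zero h) dvd_rfl
    omega
  refine ⟨n - a % n, by omega, by omega, 1 + a / n, ?_⟩
  have := Nat.mod_add_div a n
  rw [mul_add]
  omega

/-- The monomials `u ^ n`, `u ^ i v`, `v ^ n`, `u ^ (n - i) v ^ (n - 1)`, where `n` divides `i + a`,
are invariant. -/
theorem exists_invariants (hξ : IsPrimitiveRoot ξ n) {i : ℕ} (hin : i < n) (hia : n ∣ i + a) :
    ∃ A B C D : InvariantRing k (MvPowerSeries (Fin 2) k) (cyclicGroup ξ a),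
      (A : MvPowerSeries (Fin 2) k) = X 0 ^ n ∧ (B : MvPowerSeries (Fin 2) k) = X 0 ^ i * X 1 ∧
      (C : MvPowerSeries (Fin 2) k) = X 1 ^ n ∧ C * A = D * B := by
  refine ⟨⟨X 0 ^ n * X 1 ^ 0, monomial_mem_invariantRing hξ (by simp)⟩,
    ⟨X 0 ^ i * X 1 ^ 1, monomial_mem_invariantRing hξ (by simpa using hia)⟩,
    ⟨X 0 ^ 0 * X 1 ^ n, monomial_mem_invariantRing hξ (by simp)⟩,
    ⟨X 0 ^ (n - i) * X 1 ^ (n - 1), monomial_mem_invariantRing hξ ?_⟩,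
    by simp, by simp, by simp, Subtype.ext ?_⟩
  -- The weights of `D` and `B` add up to `(n - i) + a (n - 1) + (i + a) = n (1 + a)`.
  · refine (Nat.dvd_add_left hia).1 ⟨1 + a, ?_⟩
    zify [hin.le, (by omega : 1 ≤ n)]
    ring
  · change (X 0 ^ 0 * X 1 ^ n) * (X 0 ^ n * X 1 ^ 0) =
      (X 0 ^ (n - i) * X 1 ^ (n - 1)) * (X 0 ^ i * X 1 ^ 1 : MvPowerSeries (Fin 2) k)
    rw [mul_mul_mul_comm, mul_mul_mul_comm (X 0 ^ (n - i)), ← pow_add, ← pow_add, ← pow_add,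
      ← pow_add, Nat.sub_add_cancel hin.le, Nat.sub_add_cancel (by omega : 1 ≤ n)]
    simp

end cyclicGroup

open MvPowerSeries in
theorem lemma4p5p5 {k : Type*} [Field k] [IsAlgClosed k] (n a : ℕ) (hn : 1 ≤ n)
    (hchar : (n : k) ≠ 0) (han : Nat.Coprime a n) (ξ : kˣ) (hξ : IsPrimitiveRoot ξ n)
    (F : MinimalFreeResolution
      (InvariantRing k (MvPowerSeries (Fin 2) k) (cyclicGroup ξ a))
      (IsLocalRing.ResidueField
        (InvariantRing k (MvPowerSeries (Fin 2) k) (cyclicGroup ξ a)))) :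
    Function.Injective
      (auslanderRep k (MvPowerSeries (Fin 2) k) (cyclicGroup ξ a) F.secondSyzygy) := by
  rw [injective_iff_map_eq_one]
  intro g hg
  obtain ⟨j, hj⟩ := cyclicGroup.exists_eq_zpow g
  suffices h : ξ ^ j = 1 by
    rw [h, map_one] at hj
    exact Subtype.ext hj
  have hjn : (ξ ^ j) ^ n = 1 := by
    rw [← zpow_natCast, ← zpow_mul, mul_comm, zpow_mul, zpow_natCast, hξ.pow_eq_one, one_zpow]
  obtain rfl | hn2 : n = 1 ∨ 2 ≤ n := by omega
  · simpa using hjn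
  have : Finite (cyclicGroup ξ a) := Nat.finite_of_card_ne_zero (by
    rw [cyclicGroup.card_eq hξ]
    omega)
  have := Fintype.ofFinite (cyclicGroup ξ a)
  have : IsDomain (MvPowerSeries (Fin 2) k) := NoZeroDivisors.to_isDomain _
  obtain ⟨i, hi0, hin, hia⟩ := cyclicGroup.exists_lt_dvd_add hn2 han
  obtain ⟨A, B, C, D, hA, hB, hC, hCA⟩ := cyclicGroup.exists_invariants hξ hin hia
  have hX : (X 0 : MvPowerSeries (Fin 2) k) ^ i ≠ 0 := fun h => by
    have := congrArg (coeff (Finsupp.single 0 i)) h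
    rw [coeff_X_pow, if_pos rfl, map_zero] at this
    exact one_ne_zero this
  obtain ⟨r, r', z, hr, hz, hgz⟩ := exists_smul_sub_mem_sq
    (fun s => cyclicGroup.mem_maximalIdeal_of_invariantTrace_mem hξ hchar) F
    (cyclicGroup.mem_maximalIdeal_of_constantCoeff_eq_zero (by
      rw [hA, map_pow, constantCoeff_X, zero_pow (by omega)]))
    (fun h => by
      have := cyclicGroup.coeff_eq_zero_of_mem_maximalIdeal_sq hξ h
      rw [hA, coeff_X_pow, if_pos rfl] at this
      exact one_ne_zero this)
    (cyclicGroup.mem_maximalIdeal_of_constantCoeff_eq_zero (by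
      rw [hB, map_mul, constantCoeff_X, mul_zero])) hCA hX
    -- Here `v^n s = u^i v s'`, and `u^i` is prime to `v^n`.
    (fun s s' h => by
      rw [hB, hC, mul_assoc] at h
      exact X_pow_dvd_of_dvd_X_pow_mul (by decide) ⟨_, h⟩)
  have hz' : z = X 1 * (r : MvPowerSeries (Fin 2) k) -
      X 0 ^ (n - i) * (r' : MvPowerSeries (Fin 2) k) := by
    refine mul_left_cancel₀ hX (hz.trans ?_)
    rw [hA, hB, mul_sub, ← mul_assoc, ← mul_assoc, ← pow_add, Nat.add_sub_cancel' hin.le]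
  -- Since `n - i > 0`, the linear `v`-term of `z` is the constant term of the unit `r`.
  have hw : coeff (Finsupp.single 1 1) z ≠ 0 := by
    rw [hz', coeff_X_one_mul_sub (by omega)]
    exact ((hr.map (InvariantRing k (MvPowerSeries (Fin 2) k) (cyclicGroup ξ a)).val).map
      (constantCoeff (σ := Fin 2) (R := k))).ne_zero
  -- The `v`-coefficient of `g • z - z` vanishes, while `g` scales that of `z` by `(ξ ^ j) ^ a`.
  have h := coeff_single_one_eq_zero_of_mem_maximalIdeal_sq (hgz g hg) 1
  rw [map_sub, cyclicGroup.coeff_smul_of_eq_diagonalHom hj, sub_eq_zero] at h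
  have hja : (ξ ^ j) ^ a = 1 := by
    ext
    have := mul_right_cancel₀ hw (h.trans (one_mul _).symm)
    simpa using this
  have := pow_gcd_eq_one.2 ⟨hja, hjn⟩
  rwa [han.gcd_eq_one, pow_one] at this
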